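/- Let $k$ be an algebraically closed field and let $X\subseteq\mathbb P^N$ be an irreducible (reduced) projective variety over $k$, of dimension $n$, embedded by the complete linear system $|L|$ of a Cartier divisor $L$; that is, the embedding is the closed immersion $x\mapsto[s_0(x):\dots:s_N(x)]$ defined by a basis $s_0,\dots,s_N$ of $H^0(X,\mathcal O_X(L))$. Let $h$ be an integer with $2h-1\ge 3$, and assume that $L=D_1+\dots+D_{2h-1}$, where every $D_j$ is a very ample Cartier divisor on $X$ (i.e. some global sections of $\mathcal O_X(D_j)$ define a closed immersion of $X$ into a projective space). For a closed point $x$ of $X$ let $T_xX\subseteq\mathbb P^N$ be the embedded (projective) tangent space; $x$ is a smooth point of $X$ if $\dim T_xX=n$. The $h$-Terracini locus $T_h(X)$ is the closure, in the symmetric product $X^h/S_h$, of the set of all $\{x_1,\dots,x_h\}$ such that $x_1,\dots,x_h$ are pairwise distinct smooth closed points of $X$ and $$\dim\langle T_{x_1}X,\dots,T_{x_h}X\rangle<\min\{hn+h-1,\,N\}.$$ Then $T_h(X)=\emptyset$. -/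

import Mathlib

open AlgebraicGeometry CategoryTheory CategoryTheory.Limits

universe u

attribute [instance] MvPolynomial.gradedAlgebra

noncomputable section

namespace Terracini

/-! ### Rational functions, Cartier divisors and their global sections -/

section Divisors

variable (k : Type u) [Field k] (X : Scheme.{u}) [IsIntegral X] [X.Over (Spec (CommRingCat.of k))]

/-- The constants `k → 𝒪_{X,x}` of a scheme `X` over `k`. -/
def constants (x : X) : k →+* X.presheaf.stalk x :=
  (X.presheaf.germ ⊤ x trivial).hom.comp
    ((X ↘ Spec (CommRingCat.of k)).appTop.hom.comp
      (Scheme.ΓSpecIso (CommRingCat.of k)).inv.hom)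

/-- The function field of an integral `k`-scheme is a `k`-algebra. -/
instance functionFieldAlgebra : Algebra k X.functionField :=
  (constants k X (genericPoint X)).toAlgebra

theorem algebraMap_constants (x : X) (c : k) :
    algebraMap (X.presheaf.stalk x) X.functionField (constants k X x c) =
      algebraMap k X.functionField c := by
  have : Nonempty (⊤ : X.Opens) := ⟨⟨x, trivial⟩⟩
  have h := Scheme.algebraMap_germ_eq_germToFunctionField X (U := ⊤) (x := x) trivial
    ((X ↘ Spec (CommRingCat.of k)).appTop ((Scheme.ΓSpecIso (CommRingCat.of k)).inv c))
  exact h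

/-- The units of `𝒪_{X,x}`, as a subgroup of `K(X)ˣ`. -/
def localUnits (x : X) : Subgroup X.functionFieldˣ :=
  (Units.map (algebraMap (X.presheaf.stalk x) X.functionField).toMonoidHom).range

/-- Global sections of the sheaf `𝒦ˣ / 𝒪ˣ` on an integral scheme: families of elements of
`K(X)ˣ / 𝒪_{X,x}ˣ` that are locally given by one rational function. -/
def cartierSubgroup : Subgroup (∀ x : X, X.functionFieldˣ ⧸ localUnits X x) where
  carrier := {D | ∀ x : X, ∃ U : X.Opens, x ∈ U ∧ ∃ f : X.functionFieldˣ,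
    ∀ y ∈ U, D y = QuotientGroup.mk f}
  one_mem' x := ⟨⊤, trivial, 1, fun _ _ => rfl⟩
  mul_mem' := by
    intro D E hD hE x
    obtain ⟨U, hU, f, hf⟩ := hD x
    obtain ⟨V, hV, g, hg⟩ := hE x
    refine ⟨U ⊓ V, ⟨hU, hV⟩, f * g, fun y hy => ?_⟩
    rw [Pi.mul_apply, hf y hy.1, hg y hy.2, QuotientGroup.mk_mul]
  inv_mem' := by
    intro D hD x
    obtain ⟨U, hU, f, hf⟩ := hD x
    refine ⟨U, hU, f⁻¹, fun y hy => ?_⟩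
    rw [Pi.inv_apply, hf y hy, QuotientGroup.mk_inv]

/-- The additive group of Cartier divisors of an integral scheme. -/
abbrev CartierDivisor : Type u := Additive (cartierSubgroup X)

variable {X}

/-- `f` is a local equation of the Cartier divisor `D` at `x`. -/
def IsLocalEquation (D : CartierDivisor X) (x : X) (f : X.functionFieldˣ) : Prop :=
  (D.toMul : ∀ x : X, X.functionFieldˣ ⧸ localUnits X x) x = QuotientGroup.mk f

/-- `H⁰(X, 𝒪_X(D))`: the rational functions `φ` with `φ f ∈ 𝒪_{X,x}` for every point `x` and every
local equation `f` of `D` at `x`. -/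
def globalSections (D : CartierDivisor X) : Submodule k X.functionField where
  carrier := {φ | ∀ (x : X) (f : X.functionFieldˣ), IsLocalEquation D x f →
    φ * f ∈ (algebraMap (X.presheaf.stalk x) X.functionField).range}
  add_mem' := by
    intro a b ha hb x f hf
    rw [add_mul]
    exact add_mem (ha x f hf) (hb x f hf)
  zero_mem' := by
    intro x f _
    rw [zero_mul]
    exact zero_mem _
  smul_mem' := by
    intro c a ha x f hf
    rw [Algebra.smul_def, mul_assoc, ← algebraMap_constants k X x c]
    exact mul_mem ⟨_, rfl⟩ (ha x f hf)

/-- The rational section `φ` of `𝒪_X(D)` generates the stalk of `𝒪_X(D)` at `x`; for a global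
section this says that it does not vanish at `x`. -/
def GeneratesAt (D : CartierDivisor X) (φ : X.functionField) (x : X) : Prop :=
  ∀ f : X.functionFieldˣ, IsLocalEquation D x f →
    ∃ u : (X.presheaf.stalk x)ˣ,
      algebraMap (X.presheaf.stalk x) X.functionField u = φ * f

end Divisors

/-! ### Projective space, very ample divisors -/

section Projective

variable (k : Type u) [Field k]

/-- Projective space `ℙ^N` over `k`. -/
abbrev ProjectiveSpace (N : ℕ) : Scheme.{u} :=
  Proj (MvPolynomial.homogeneousSubmodule (Fin (N + 1)) k)

instance projectiveSpaceOver (N : ℕ) : (ProjectiveSpace k N).Over (Spec (CommRingCat.of k)) where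
  hom := Proj.toSpecZero _ ≫ Spec.map (CommRingCat.ofHom
    (algebraMap k (MvPolynomial.homogeneousSubmodule (Fin (N + 1)) k 0)))

variable {k}

/-- The homogeneous prime ideal of `k[X₀, …, X_N]` of a point of `ℙ^N`. -/
def pointIdeal {N : ℕ} (y : ProjectiveSpace k N) : Ideal (MvPolynomial (Fin (N + 1)) k) :=
  y.asHomogeneousIdeal.toIdeal

/-- The germ at `y` of the regular function `X_l / X_j`, where `X_j` does not vanish at `y`. -/
def coordRatio {N : ℕ} (y : ProjectiveSpace k N) (l j : Fin (N + 1))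
    (hj : MvPolynomial.X j ∉ pointIdeal y) : (ProjectiveSpace k N).presheaf.stalk y :=
  (Proj.stalkIso (MvPolynomial.homogeneousSubmodule (Fin (N + 1)) k) y).inv
    (HomogeneousLocalization.mk
      { deg := 1
        num := ⟨MvPolynomial.X l, MvPolynomial.isHomogeneous_X k l⟩
        den := ⟨MvPolynomial.X j, MvPolynomial.isHomogeneous_X k j⟩
        den_mem := hj })

/-- `i : X → ℙ^N` is the `k`-morphism `x ↦ [s₀(x) : … : s_N(x)]` defined by the global sections
`s₀, …, s_N` of `𝒪_X(D)`: a coordinate `X_j` vanishes at `i(x)` iff `s_j` vanishes at `x`, and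
`X_l / X_j` pulls back to `s_l / s_j`. (In particular the `s_j` have no common zero.) -/
structure IsDefinedBySections {X : Scheme.{u}} [IsIntegral X] [X.Over (Spec (CommRingCat.of k))]
    {N : ℕ} (i : X ⟶ ProjectiveSpace k N) (D : CartierDivisor X)
    (s : Fin (N + 1) → X.functionField) : Prop where
  isOver : i.IsOver (Spec (CommRingCat.of k))
  mem_globalSections : ∀ j, s j ∈ globalSections k D
  generatesAt_iff : ∀ (x : X) (j : Fin (N + 1)),
    GeneratesAt D (s j) x ↔ MvPolynomial.X j ∉ pointIdeal (i x)
  pullback_coordRatio : ∀ (x : X) (l j : Fin (N + 1)) (hj : MvPolynomial.X j ∉ pointIdeal (i x)),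
    algebraMap (X.presheaf.stalk x) X.functionField (i.stalkMap x (coordRatio (i x) l j hj)) =
      s l / s j

variable (k) in
/-- A Cartier divisor `D` on a projective variety is very ample if some global sections of
`𝒪_X(D)` define a closed immersion into a projective space. -/
def IsVeryAmple {X : Scheme.{u}} [IsIntegral X] [X.Over (Spec (CommRingCat.of k))]
    (D : CartierDivisor X) : Prop :=
  ∃ (M : ℕ) (i : X ⟶ ProjectiveSpace k M) (s : Fin (M + 1) → X.functionField),
    IsClosedImmersion i ∧ IsDefinedBySections i D s

/-- `i : X → ℙ^N` embeds `X` by the complete linear system `|L|`: it is a closed immersion, and it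
is defined by a basis of `H⁰(X, 𝒪_X(L))`. -/
def IsEmbeddingByCompleteLinearSystem {X : Scheme.{u}} [IsIntegral X]
    [X.Over (Spec (CommRingCat.of k))] {N : ℕ} (i : X ⟶ ProjectiveSpace k N)
    (L : CartierDivisor X) : Prop :=
  IsClosedImmersion i ∧ ∃ s : Fin (N + 1) → X.functionField,
    IsDefinedBySections i L s ∧ LinearIndependent k s ∧
      Submodule.span k (Set.range s) = globalSections k L

end Projective

/-! ### Tangent spaces and Terracini loci -/

section Terracini

variable {k : Type u} [Field k] {X : Scheme.{u}} {N : ℕ}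

/-- `p ∈ k^{N+1}` is a vector of homogeneous coordinates of the point `y` of `ℙ^N`. -/
def IsHomogeneousCoordinates (y : ProjectiveSpace k N) (p : Fin (N + 1) → k) : Prop :=
  p ≠ 0 ∧ ∀ (d : ℕ) (F : MvPolynomial (Fin (N + 1)) k), F.IsHomogeneous d →
    (F ∈ pointIdeal y ↔ MvPolynomial.eval p F = 0)

/-- The embedded tangent space `T_x X ⊆ ℙ^N` at a closed point `x`, as the linear subspace of
`k^{N+1}` lying over it: the `v` with `∑_j ∂F/∂X_j(p) v_j = 0` for all homogeneous `F` that vanish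
on `X`, where `p` is a vector of homogeneous coordinates of `x`. -/
def tangentSpace (i : X ⟶ ProjectiveSpace k N) (x : X) : Submodule k (Fin (N + 1) → k) where
  carrier := {v | ∀ (d : ℕ) (F : MvPolynomial (Fin (N + 1)) k), F.IsHomogeneous d →
    (∀ z : X, F ∈ pointIdeal (i z)) →
    ∀ p : Fin (N + 1) → k, IsHomogeneousCoordinates (i x) p →
      ∑ j, MvPolynomial.eval p (MvPolynomial.pderiv j F) * v j = 0}
  add_mem' := by
    intro v w hv hw d F hF hX p hp
    simp only [Pi.add_apply, mul_add, Finset.sum_add_distrib, hv d F hF hX p hp,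
      hw d F hF hX p hp, add_zero]
  zero_mem' := by
    intro d F _ _ p _
    simp
  smul_mem' := by
    intro c v hv d F hF hX p hp
    have h := hv d F hF hX p hp
    simp only [Pi.smul_apply, smul_eq_mul, mul_left_comm _ c, ← Finset.mul_sum, h, mul_zero]

/-- The dimension of the linear subspace of `ℙ^N` lying under a subspace of `k^{N+1}`. -/
def projDim (W : Submodule k (Fin (N + 1) → k)) : ℤ := (Module.finrank k W : ℤ) - 1

variable (X) in
/-- The dimension of a (nonempty, finite dimensional) scheme. -/
def dimension : ℕ := ((topologicalKrullDim X).unbotD 0).toNat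

/-- `X ⊆ ℙ^N` is smooth at the closed point `x`: the embedded tangent space at `x` has the
dimension of `X`. -/
def IsSmoothPoint (i : X ⟶ ProjectiveSpace k N) (x : X) : Prop :=
  projDim (tangentSpace i x) = dimension X

variable (k X) [X.Over (Spec (CommRingCat.of k))] (h : ℕ)

/-- The `h`-fold product `X^h = X × ⋯ × X` over `k`. -/
abbrev power : Scheme.{u} :=
  widePullback (Spec (CommRingCat.of k)) (fun _ : Fin h => X)
    (fun _ => X ↘ Spec (CommRingCat.of k))

/-- The `j`-th projection `X^h → X`. -/
abbrev powerProj (j : Fin h) : power k X h ⟶ X :=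
  WidePullback.π (fun _ : Fin h => X ↘ Spec (CommRingCat.of k)) j

/-- The permutation of the factors of `X^h` by `σ ∈ S_h`. -/
def powerPerm (σ : Equiv.Perm (Fin h)) : power k X h ⟶ power k X h :=
  WidePullback.lift (WidePullback.base _) (fun j => powerProj k X h (σ j))
    (fun j => WidePullback.π_arrow _ (σ j))

/-- The symmetric product `X^h / S_h`, as a topological space. -/
abbrev SymmetricProduct : Type u :=
  Quot (fun z w : power k X h => ∃ σ : Equiv.Perm (Fin h), powerPerm k X h σ z = w)

variable {k X}

/-- The set of all `{x₁, …, x_h}` in `X^h / S_h`, where the `x_j` are pairwise distinct smooth closed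
points of `X` (over an algebraically closed field, the closed points `z` of `X^h` are the `h`-tuples
of closed points of `X`) with `dim ⟨T_{x₁} X, …, T_{x_h} X⟩ < min {hn + h - 1, N}`, `n = dim X`. -/
def terraciniSet (i : X ⟶ ProjectiveSpace k N) : Set (SymmetricProduct k X h) :=
  {ξ | ∃ z : power k X h, IsClosed {z} ∧ Quot.mk _ z = ξ ∧
    Function.Injective (fun j => powerProj k X h j z) ∧
    (∀ j, IsSmoothPoint i (powerProj k X h j z)) ∧
    projDim (⨆ j, tangentSpace i (powerProj k X h j z)) <
      min ((h : ℤ) * dimension X + h - 1) N}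

/-- The `h`-Terracini locus `T_h(X)`, the closure of `terraciniSet` in `X^h / S_h`. -/
def terraciniLocus (i : X ⟶ ProjectiveSpace k N) : Set (SymmetricProduct k X h) :=
  closure (terraciniSet h i)

end Terracini

end Terracini

end

/-! The tangent spaces at `h` distinct closed points are linearly independent, so their span always
has the expected dimension and the Terracini set is empty before taking closures.

Fix a point `x_j`. Since `2h - 1 = 1 + 2(h - 1)`, one divisor `D₀` can be reserved for `x_j` and two
for each other point `x_{j'}`. Very ampleness gives, for each of the latter divisors, a section
vanishing at its `x_{j'}` but not at `x_j` (`IsVeryAmple.exists_separating`). The product of these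
sections with any section `t_m` embedding `X` by `D₀` is a section of `L`, hence a linear form on
`ℙ^N` because the linear system is complete. It vanishes doubly at each `x_{j'}`, so it kills the
tangent space there (`sum_mul_eq_zero_of_two_vanishing`). At `x_j` it is `t_m` times a nonvanishing
factor, and the `t_m` detect all tangent vectors (`eq_zero_of_sum_mul_eq_zero`). A vector of the
tangent space at `x_j` lying in the span of the others is therefore zero.

Tangent vectors are handled as algebra maps from the local ring to the dual numbers
(`exists_tangentLift`). -/

noncomputable section
namespace Terracini

/-! ### Projective space over `k`: constants and finite type. -/

section StructureMorphism

variable {k : Type u} [Field k]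

/-- A splitting `j` forces `U` to be all of `X`. This removes the identification of `D₊(1)` with
`Proj` from the definition of `Proj.toSpecZero`. -/
theorem appTop_section_germ {X : Scheme.{u}} (U : X.Opens) (j : X ⟶ U) (hj : j ≫ U.ι = 𝟙 X) (x : X)
    (hx : x ∈ U) :
    U.topIso.inv ≫ j.appTop ≫ X.presheaf.germ ⊤ x (TopologicalSpace.Opens.mem_top x) =
      X.presheaf.germ U x hx := by
  have hle : (⊤ : X.Opens) ≤ (j ≫ U.ι) ⁻¹ᵁ U := by
    intro y _
    exact (j y).2
  have h1 : U.topIso.inv ≫ j.appTop = (j ≫ U.ι).appLE U ⊤ hle := by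
    have h2 : U.topIso.inv = U.ι.appLE U ⊤ (by simp) := by
      simp only [Scheme.Opens.topIso_inv, Scheme.Opens.ι_appLE]; rfl
    have h3 : j.appTop = j.appLE ⊤ ⊤ (le_of_eq rfl : (⊤ : X.Opens) ≤ j ⁻¹ᵁ ⊤) := by
      simp only [Scheme.Hom.appLE]
      exact ((congrArg _ (X.presheaf.map_id _)).trans (Category.comp_id _)).symm
    rw [h2, h3, Scheme.Hom.appLE_comp_appLE]
  rw [reassoc_of% h1]
  have h3 : ∀ (g : X ⟶ X) (_ : g = 𝟙 X) (e : (⊤ : X.Opens) ≤ g ⁻¹ᵁ U),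
      g.appLE U ⊤ e ≫ X.presheaf.germ ⊤ x (TopologicalSpace.Opens.mem_top x) =
        X.presheaf.germ U x hx := by
    rintro g rfl e
    rw [Scheme.Hom.appLE, Category.assoc, TopCat.Presheaf.germ_res]
    exact Category.id_comp _
  exact h3 _ hj _

theorem toSpecZero_appTop_germ {σ : Type*} {A : Type u} [CommRing A] [SetLike σ A]
    [AddSubgroupClass σ A] (𝒜 : ℕ → σ) [GradedRing 𝒜] (y : Proj 𝒜) :
    (Scheme.ΓSpecIso (CommRingCat.of (𝒜 0))).inv ≫ (Proj.toSpecZero 𝒜).appTop ≫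
      (Proj 𝒜).presheaf.germ ⊤ y (TopologicalSpace.Opens.mem_top y) =
    CommRingCat.ofHom (HomogeneousLocalization.fromZeroRingHom 𝒜 _) ≫ (Proj.stalkIso 𝒜 y).inv := by
  have hj : ((Scheme.topIso _).inv ≫ (Scheme.isoOfEq _ (Proj.basicOpen_one 𝒜)).inv) ≫
      (Proj.basicOpen 𝒜 1).ι = 𝟙 _ := by simp
  have h := appTop_section_germ _ _ hj y (by simp)
  have h0 : Proj.awayToSection 𝒜 1 ≫ (Proj 𝒜).presheaf.germ _ y _ = _ :=
    ProjectiveSpectrum.Proj.awayToSection_germ 𝒜 1 y (by exact (Proj.basicOpen_one 𝒜).ge trivial)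
  rw [Proj.toSpecZero, ← Category.assoc (Scheme.topIso _).inv]
  rw [Scheme.Hom.comp_appTop, Scheme.Hom.comp_appTop]
  have h4 : (Proj.basicOpenToSpec 𝒜 1).appTop = _ := Proj.basicOpenToSpec_app_top 𝒜 1
  rw [h4]
  simp only [Category.assoc]
  rw [h, ← Scheme.ΓSpecIso_inv_naturality_assoc, Iso.inv_hom_id_assoc, h0]
  rfl

instance (N : ℕ) : IsScalarTower k (MvPolynomial.homogeneousSubmodule (Fin (N + 1)) k 0)
    (MvPolynomial (Fin (N + 1)) k) := IsScalarTower.of_algebraMap_eq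
      (R := k) (S := MvPolynomial.homogeneousSubmodule (Fin (N + 1)) k 0)
      (A := MvPolynomial (Fin (N + 1)) k) fun _ => rfl

instance (N : ℕ) : Algebra.FiniteType (MvPolynomial.homogeneousSubmodule (Fin (N + 1)) k 0)
    (MvPolynomial (Fin (N + 1)) k) :=
  Algebra.FiniteType.of_restrictScalars_finiteType k _ _

theorem algebraMap_homogeneousSubmodule_zero_bijective (N : ℕ) : Function.Bijective
    (algebraMap k (MvPolynomial.homogeneousSubmodule (Fin (N + 1)) k 0)) := by
  constructor
  · intro a b hab
    exact MvPolynomial.C_injective (Fin (N + 1)) k (congrArg Subtype.val hab)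
  · intro ⟨F, hF⟩
    have h := MvPolynomial.totalDegree_eq_zero_iff_eq_C.mp
      ((MvPolynomial.totalDegree_zero_iff_isHomogeneous _).2 hF)
    exact ⟨_, Subtype.ext h.symm⟩

instance locallyOfFiniteType_projectiveSpace (N : ℕ) :
    LocallyOfFiniteType (ProjectiveSpace k N ↘ Spec (CommRingCat.of k)) := by
  let e : CommRingCat.of k ≅ CommRingCat.of (MvPolynomial.homogeneousSubmodule (Fin (N + 1)) k 0) :=
    (RingEquiv.ofBijective _ (algebraMap_homogeneousSubmodule_zero_bijective N)).toCommRingCatIso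
  have : IsIso (Spec.map (CommRingCat.ofHom
    (algebraMap k (MvPolynomial.homogeneousSubmodule (Fin (N + 1)) k 0)))) :=
    inferInstanceAs (IsIso (Spec.map e.hom))
  exact inferInstanceAs (LocallyOfFiniteType (_ ≫ _))

/-- This makes the comorphism on stalks `k`-linear, so that polynomials over `k` can be evaluated
through it. -/
theorem constants_stalkMap {X : Scheme.{u}} [IsIntegral X] [X.Over (Spec (CommRingCat.of k))]
    {N : ℕ} (i : X ⟶ ProjectiveSpace k N) (hi : i.IsOver (Spec (CommRingCat.of k))) (x : X) :
    constants k X x = (i.stalkMap x).hom.comp (((Proj.stalkIso _ (i x)).inv.hom.comp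
     (HomogeneousLocalization.fromZeroRingHom
       (MvPolynomial.homogeneousSubmodule (Fin (N + 1)) k) _)).comp (algebraMap k _)) := by
  have h1 := toSpecZero_appTop_germ (MvPolynomial.homogeneousSubmodule (Fin (N + 1)) k) (i x)
  have h2 : i ≫ (Proj.toSpecZero _ ≫ Spec.map (CommRingCat.ofHom
    (algebraMap k (MvPolynomial.homogeneousSubmodule (Fin (N + 1)) k 0)))) =
      X ↘ Spec (CommRingCat.of k) := hi.1
  have h3 : CommRingCat.ofHom (constants k X x) = (Scheme.ΓSpecIso (CommRingCat.of k)).inv ≫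
    (X ↘ Spec (CommRingCat.of k)).appTop ≫
      X.presheaf.germ ⊤ x (TopologicalSpace.Opens.mem_top x) := rfl
  suffices CommRingCat.ofHom (constants k X x) = CommRingCat.ofHom (algebraMap k _) ≫
    (CommRingCat.ofHom (HomogeneousLocalization.fromZeroRingHom
       (MvPolynomial.homogeneousSubmodule (Fin (N + 1)) k) _) ≫ (Proj.stalkIso _ (i x)).inv) ≫
        i.stalkMap x from congrArg CommRingCat.Hom.hom this
  have h5 := Scheme.Hom.germ_stalkMap i ⊤ x (TopologicalSpace.Opens.mem_top _)
  rw [h3, ← h2, ← h1]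
  simp only [Category.assoc]
  rw [h5, Scheme.Hom.comp_appTop, Scheme.Hom.comp_appTop, Scheme.ΓSpecIso_inv_naturality_assoc]
  simp only [Category.assoc]
  rfl

end StructureMorphism

open MvPolynomial

/-! ### Homogeneous fractions at a point of projective space. -/

section Fractions

variable {k : Type u} [Field k]

theorem eval₂_mul_of_isHomogeneous {ι A B : Type*} [CommSemiring A] [CommSemiring B] (φ : A →+* B)
    {F : MvPolynomial ι A} {d : ℕ} (hF : F.IsHomogeneous d) (c : B) (g : ι → B) :
    F.eval₂ φ (fun l => c * g l) = c ^ d * F.eval₂ φ g := by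
  rw [eval₂_eq, eval₂_eq, Finset.mul_sum]
  refine Finset.sum_congr rfl fun m hm => ?_
  simp only [mul_pow]
  rw [Finset.prod_mul_distrib, Finset.prod_pow_eq_pow_sum,
    show ∑ i ∈ m.support, m i = d from hF.degree_eq_sum_deg_support hm |>.symm]
  ring

theorem localization_mk_mul_algebraMap {A : Type*} [CommRing A] (S : Submonoid A) (a : A) (s : S) :
    Localization.mk a s * algebraMap A (Localization S) s = algebraMap A (Localization S) a := by
  rw [Localization.mk_eq_mk']
  exact IsLocalization.mk'_spec _ _ _

variable {N : ℕ} (y : ProjectiveSpace k N)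

instance : (pointIdeal y).IsPrime := y.isPrime

/-- Homogeneous fractions of the coordinate ring at a point of projective space. -/
abbrev HomFrac : Type u :=
  HomogeneousLocalization.AtPrime (homogeneousSubmodule (Fin (N + 1)) k)
    (pointIdeal y)

/-- The constants in the ring of homogeneous fractions. -/
def fracConstants : k →+* HomFrac y :=
  (HomogeneousLocalization.fromZeroRingHom (homogeneousSubmodule (Fin (N + 1)) k) _).comp
    (algebraMap k _)

variable {y}

/-- The homogeneous fraction `F / X_j ^ d`. -/
def homFrac {j : Fin (N + 1)} (hj : X j ∉ pointIdeal y) {d : ℕ} {F : MvPolynomial (Fin (N + 1)) k}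
    (hF : F.IsHomogeneous d) : HomFrac y :=
  HomogeneousLocalization.mk
    { deg := d
      num := ⟨F, hF⟩
      den := ⟨X j ^ d, by simpa using (isHomogeneous_X k j).pow d⟩
      den_mem := fun h => hj (y.isPrime.mem_of_pow_mem d h) }

theorem homFrac_val {j : Fin (N + 1)} (hj : X j ∉ pointIdeal y) {d : ℕ}
    {F : MvPolynomial (Fin (N + 1)) k} (hF : F.IsHomogeneous d) :
    algebraMap _ (Localization.AtPrime (pointIdeal y)) (homFrac hj hF) *
      algebraMap (MvPolynomial (Fin (N + 1)) k) _ (X j) ^ d = algebraMap _ _ F := by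
  rw [← map_pow]
  exact localization_mk_mul_algebraMap _ _ _

theorem isUnit_homFrac_iff {j : Fin (N + 1)} (hj : X j ∉ pointIdeal y) {d : ℕ}
    {F : MvPolynomial (Fin (N + 1)) k} (hF : F.IsHomogeneous d) :
    IsUnit (homFrac hj hF) ↔ F ∉ pointIdeal y := by
  have hX : IsUnit (algebraMap (MvPolynomial (Fin (N + 1)) k)
      (Localization.AtPrime (pointIdeal y)) (X j) ^ d) :=
    IsUnit.pow _ (IsLocalization.map_units _ (⟨X j, hj⟩ : (pointIdeal y).primeCompl))
  have h := HomogeneousLocalization.isUnit_iff_isUnit_val _ _ (homFrac hj hF)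
  have h2 := homFrac_val hj hF
  rw [← h]
  have h3 : IsUnit (homFrac hj hF).val ↔ IsUnit (algebraMap (MvPolynomial (Fin (N + 1)) k)
      (Localization.AtPrime (pointIdeal y)) F) := by
    rw [← h2, IsUnit.mul_iff]
    exact ⟨fun h => ⟨h, hX⟩, fun h => h.1⟩
  rw [h3]
  exact IsLocalization.AtPrime.isUnit_to_map_iff _ _ _

/-- Dehomogenization: in the localization both sides become `F` after multiplication by the unit
`X_j ^ d`. -/
theorem eval₂_coordinates {j : Fin (N + 1)} (hj : X j ∉ pointIdeal y) {d : ℕ}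
    {F : MvPolynomial (Fin (N + 1)) k} (hF : F.IsHomogeneous d) :
    F.eval₂ (fracConstants y) (fun l => homFrac hj (isHomogeneous_X k l)) = homFrac hj hF := by
  apply HomogeneousLocalization.val_injective
  rw [← HomogeneousLocalization.algebraMap_apply, ← HomogeneousLocalization.algebraMap_apply]
  have hX : IsUnit (algebraMap (MvPolynomial (Fin (N + 1)) k)
      (Localization.AtPrime (pointIdeal y)) (X j) ^ d) :=
    IsUnit.pow _ (IsLocalization.map_units _ (⟨X j, hj⟩ : (pointIdeal y).primeCompl))
  rw [← hX.mul_left_inj, homFrac_val, hom_eval₂, mul_comm, ← eval₂_mul_of_isHomogeneous _ hF]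
  have h1 : (fun l => algebraMap (MvPolynomial (Fin (N + 1)) k)
      (Localization.AtPrime (pointIdeal y)) (X j) *
        algebraMap (HomFrac y) _ (homFrac hj (isHomogeneous_X k l))) =
      fun l => algebraMap (MvPolynomial (Fin (N + 1)) k) _ (X l) := by
    funext l
    have := homFrac_val hj (isHomogeneous_X k l)
    rw [pow_one] at this
    rw [mul_comm]
    exact this
  erw [h1]
  have h2 : (algebraMap (HomFrac y) (Localization.AtPrime (pointIdeal y))).comp
      (fracConstants y) = (algebraMap (MvPolynomial (Fin (N + 1)) k) _).comp C := by
    ext c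
    exact Localization.mk_one_eq_algebraMap _
  rw [h2, ← hom_eval₂, eval₂_eta]

theorem exists_homFrac {j : Fin (N + 1)} (hj : X j ∉ pointIdeal y) (a : HomFrac y) :
    ∃ (d : ℕ) (F G : MvPolynomial (Fin (N + 1)) k) (hF : F.IsHomogeneous d)
      (hG : G.IsHomogeneous d), IsUnit (homFrac hj hG) ∧ a * homFrac hj hG = homFrac hj hF := by
  obtain ⟨⟨d, ⟨F, hF⟩, ⟨G, hG⟩, hGy⟩, rfl⟩ := HomogeneousLocalization.mk_surjective a
  refine ⟨d, F, G, hF, hG, (isUnit_homFrac_iff hj hG).mpr hGy, ?_⟩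
  apply HomogeneousLocalization.val_injective
  have hX : IsUnit (algebraMap (MvPolynomial (Fin (N + 1)) k)
      (Localization.AtPrime (pointIdeal y)) (X j) ^ d) :=
    IsUnit.pow _ (IsLocalization.map_units _ (⟨X j, hj⟩ : (pointIdeal y).primeCompl))
  rw [← hX.mul_left_inj, HomogeneousLocalization.val_mul, mul_assoc]
  refine ((congrArg _ (homFrac_val hj hG)).trans ?_).trans (homFrac_val hj hF).symm
  exact localization_mk_mul_algebraMap _ _ _

end Fractions

/-! ### Local rings of `X` in terms of ratios of sections. -/

section Charts

variable {k : Type u} [Field k]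

/-- The family `r` generates `R` as a localization of a `k`-algebra of finite type. -/
def GeneratesFractions (k : Type*) [Field k] {ι R : Type*} [CommRing R] [Algebra k R] (r : ι → R) :
    Prop :=
  ∀ a : R, ∃ F G : MvPolynomial ι k, IsUnit (aeval r G) ∧ a * aeval r G = aeval r F

variable {X : Scheme.{u}} [AlgebraicGeometry.IsIntegral X] [X.Over (Spec (CommRingCat.of k))]

instance stalkAlgebra (x : X) : Algebra k (X.presheaf.stalk x) := (constants k X x).toAlgebra

instance (x : X) : IsScalarTower k (X.presheaf.stalk x) X.functionField :=
  IsScalarTower.of_algebraMap_eq fun c => (algebraMap_constants k X x c).symm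

theorem algebraMap_stalk_injective (x : X) :
    Function.Injective (algebraMap (X.presheaf.stalk x) X.functionField) :=
  IsFractionRing.injective _ _

variable {N : ℕ} {i : X ⟶ ProjectiveSpace k N} {D : CartierDivisor X}
  {s : Fin (N + 1) → X.functionField}

/-- The comorphism `𝒪_{ℙ^N, i(x)} → 𝒪_{X, x}`, with its source written as homogeneous fractions. -/
def fracToStalk {X : Scheme.{u}} (i : X ⟶ ProjectiveSpace k N) (x : X) :
    HomFrac (i x) →+* X.presheaf.stalk x :=
  (i.stalkMap x).hom.comp (Proj.stalkIso (homogeneousSubmodule (Fin (N + 1)) k) (i x)).inv.hom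

theorem fracToStalk_isLocalHom {X : Scheme.{u}} (i : X ⟶ ProjectiveSpace k N) (x : X) :
    IsLocalHom (fracToStalk i x) := by
  have : IsLocalHom (Proj.stalkIso (homogeneousSubmodule (Fin (N + 1)) k) (i x)).inv.hom :=
    isLocalHom_of_isIso _
  exact @RingHom.isLocalHom_comp _ _ _ _ _ _ (i.stalkMap x).hom
    (Proj.stalkIso (homogeneousSubmodule (Fin (N + 1)) k) (i x)).inv.hom inferInstance this

theorem fracToStalk_surjective {X : Scheme.{u}} (i : X ⟶ ProjectiveSpace k N) [IsClosedImmersion i]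
    (x : X) : Function.Surjective (fracToStalk i x) := by
  have h : Function.Surjective
      (Proj.stalkIso (homogeneousSubmodule (Fin (N + 1)) k) (i x)).inv.hom :=
    (Proj.stalkIso (homogeneousSubmodule (Fin (N + 1)) k)
      (i x)).commRingCatIsoToRingEquiv.symm.surjective
  exact (i.stalkMap_surjective x).comp h

/-- The `r l` are the pullbacks of `X_l / X_j`. The unit criterion holds because the comorphism is
local, the generation because it is surjective for a closed immersion. -/
theorem IsDefinedBySections.exists_ratios (h : IsDefinedBySections i D s) (x : X) {j : Fin (N + 1)}
    (hj : MvPolynomial.X j ∉ pointIdeal (i x)) :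
    ∃ r : Fin (N + 1) → X.presheaf.stalk x,
      (∀ l, algebraMap (X.presheaf.stalk x) X.functionField (r l) = s l / s j) ∧
      (∀ (d : ℕ) (F : MvPolynomial (Fin (N + 1)) k), F.IsHomogeneous d →
        (IsUnit (aeval r F) ↔ F ∉ pointIdeal (i x))) ∧
      (IsClosedImmersion i → GeneratesFractions k r) := by
  let θ := fracToStalk i x
  have hθ : θ.comp (fracConstants (i x)) = algebraMap k (X.presheaf.stalk x) :=
    (constants_stalkMap i h.isOver x).symm
  have hθloc : IsLocalHom θ := fracToStalk_isLocalHom i x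
  have key : ∀ (d : ℕ) (F : MvPolynomial (Fin (N + 1)) k) (hF : F.IsHomogeneous d),
      aeval (fun l => θ (homFrac hj (isHomogeneous_X k l))) F = θ (homFrac hj hF) := by
    intro d F hF
    rw [← eval₂_coordinates hj hF, hom_eval₂, hθ]
    rfl
  refine ⟨fun l => θ (homFrac hj (isHomogeneous_X k l)), fun l => ?_, fun d F hF => ?_,
    fun hi a => ?_⟩
  · rw [← h.pullback_coordRatio x l j hj]
    beta_reduce
    -- The two fractions differ only in the denominator: `X_j ^ 1` against `X_j`.
    have h1 : homFrac hj (isHomogeneous_X k l) = HomogeneousLocalization.mk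
      { deg := 1
        num := ⟨MvPolynomial.X l, MvPolynomial.isHomogeneous_X k l⟩
        den := ⟨MvPolynomial.X j, MvPolynomial.isHomogeneous_X k j⟩
        den_mem := hj } := by
      apply HomogeneousLocalization.val_injective
      simp [homFrac]
    rw [h1]
    rfl
  · rw [key d F hF, isUnit_map_iff, isUnit_homFrac_iff]
  · obtain ⟨c, rfl⟩ := fracToStalk_surjective i x a
    obtain ⟨d, F, G, hF, hG, hGu, hFG⟩ := exists_homFrac hj c
    refine ⟨F, G, ?_, ?_⟩
    · rw [key d G hG]
      exact hGu.map θ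
    · rw [key d G hG, key d F hF, ← hFG, map_mul]

end Charts

/-! ### Closed points of `X` and of `X^h` as `k`-points. -/

section ClosedPoints

variable {k : Type u} [Field k]

theorem fromSpecStalk_over {X : Scheme.{u}} [AlgebraicGeometry.IsIntegral X]
    [X.Over (Spec (CommRingCat.of k))] (x : X) :
    X.fromSpecStalk x ≫ (X ↘ Spec (CommRingCat.of k)) =
      Spec.map (CommRingCat.ofHom (constants k X x)) := by
  refine ext_to_Spec ?_
  change (Scheme.ΓSpecIso (CommRingCat.of k)).inv ≫
    (X.fromSpecStalk x ≫ (X ↘ Spec (CommRingCat.of k))).appTop =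
    (Scheme.ΓSpecIso (CommRingCat.of k)).inv ≫
      (Spec.map (CommRingCat.ofHom (constants k X x))).appTop
  rw [Scheme.Hom.comp_appTop, Scheme.fromSpecStalk_appTop]
  have h3 : CommRingCat.ofHom (constants k X x) = (Scheme.ΓSpecIso (CommRingCat.of k)).inv ≫
    (X ↘ Spec (CommRingCat.of k)).appTop ≫
      X.presheaf.germ ⊤ x (TopologicalSpace.Opens.mem_top x) := rfl
  rw [← Scheme.ΓSpecIso_inv_naturality, h3]
  simp only [Category.assoc]
  rfl

variable [IsAlgClosed k]

/-- Nullstellensatz: the residue field at a closed point is `k`. -/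
theorem exists_evaluation {X : Scheme.{u}} [AlgebraicGeometry.IsIntegral X]
    [X.Over (Spec (CommRingCat.of k))] [LocallyOfFiniteType (X ↘ Spec (CommRingCat.of k))] {x : X}
    (hx : IsClosed {x}) : Nonempty (X.presheaf.stalk x →ₐ[k] k) := by
  let e := residueFieldIsoBase (X ↘ Spec (CommRingCat.of k)) x hx
  have h : e.inv = CommRingCat.ofHom (constants k X x) ≫ X.residue x := by
    apply Spec.map_injective
    rw [SpecMap_residueFieldIsoBase_inv, Spec.map_comp, ← fromSpecStalk_over]
    rfl
  refine ⟨⟨(X.residue x ≫ e.hom).hom, fun c => ?_⟩⟩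
  have h2 : CommRingCat.ofHom (constants k X x) ≫ X.residue x ≫ e.hom = 𝟙 _ := by
    rw [← Category.assoc, ← h, e.inv_hom_id]
  exact congrArg (fun g => g.hom c) h2

/-! ### Wide pullbacks as iterated fibre products. -/

section WidePullback

variable {C : Type*} [Category* C] {S : C}

/-- The structure morphism of a wide pullback. -/
def widePullbackBase {J : Type*} {Y : J → C} (f : ∀ j, Y j ⟶ S) [HasWidePullback S Y f] :
    widePullback S Y f ⟶ S :=
  WidePullback.base f

variable {h : ℕ} {Y : Fin (h + 1) → C} (f : ∀ j, Y j ⟶ S)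
  [HasWidePullback S Y f]

theorem π_zero_comp : WidePullback.π f 0 ≫ f 0 = widePullbackBase f :=
  WidePullback.π_arrow f 0

variable [HasWidePullback S (fun j : Fin h => Y j.succ) fun j => f j.succ]

/-- Forget the first factor of a wide pullback. -/
def widePullbackTail : widePullback S Y f ⟶ widePullback S _ fun j : Fin h => f j.succ :=
  WidePullback.lift (widePullbackBase f) (fun j : Fin h => WidePullback.π f j.succ)
    (fun j => WidePullback.π_arrow f j.succ)

theorem widePullbackTail_base :
    widePullbackTail f ≫ widePullbackBase (fun j : Fin h => f j.succ) = widePullbackBase f :=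
  WidePullback.lift_base _ _ _ _

theorem widePullbackTail_π (j : Fin h) :
    widePullbackTail f ≫ WidePullback.π (fun j : Fin h => f j.succ) j = WidePullback.π f j.succ :=
  WidePullback.lift_π _ _ _ _ _

variable [HasPullback (widePullbackBase fun j : Fin h => f j.succ) (f 0)]

/-- Add a first factor to a wide pullback. -/
def widePullbackCons :
    pullback (widePullbackBase fun j : Fin h => f j.succ) (f 0) ⟶ widePullback S Y f :=
  WidePullback.lift (pullback.fst _ _ ≫ widePullbackBase _)
    (Fin.cons (pullback.snd _ _)
      fun j : Fin h => pullback.fst _ _ ≫ WidePullback.π (fun j : Fin h => f j.succ) j)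
    (by
      intro j
      refine Fin.cases ?_ (fun j => ?_) j
      · exact pullback.condition.symm
      · exact (Category.assoc _ _ _).trans
          (congrArg _ (WidePullback.π_arrow (fun j : Fin h => f j.succ) j)))

theorem widePullbackCons_base :
    widePullbackCons f ≫ widePullbackBase f = pullback.fst _ _ ≫ widePullbackBase _ :=
  WidePullback.lift_base _ _ _ _

theorem widePullbackCons_π_zero :
    widePullbackCons f ≫ WidePullback.π f 0 = pullback.snd _ _ :=
  WidePullback.lift_π _ _ _ _ _

theorem widePullbackCons_π_succ (j : Fin h) :
    widePullbackCons f ≫ WidePullback.π f j.succ =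
      pullback.fst _ _ ≫ WidePullback.π (fun j : Fin h => f j.succ) j :=
  WidePullback.lift_π _ _ _ _ _

/-- A wide pullback of `h + 1` morphisms is a fibre product of one of `h` morphisms with another
morphism. -/
def widePullbackSuccIso :
    widePullback S Y f ≅ pullback (widePullbackBase fun j : Fin h => f j.succ) (f 0) where
  hom := pullback.lift (widePullbackTail f) (WidePullback.π f 0)
    ((widePullbackTail_base f).trans (π_zero_comp f).symm)
  inv := widePullbackCons f
  hom_inv_id := by
    refine WidePullback.hom_ext _ _ _ (fun j => ?_) ?_
    · refine Fin.cases ?_ (fun j => ?_) j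
      · rw [Category.assoc, widePullbackCons_π_zero, pullback.lift_snd, Category.id_comp]
      · rw [Category.assoc, widePullbackCons_π_succ, pullback.lift_fst_assoc, Category.id_comp,
          widePullbackTail_π]
    · change (_ ≫ _) ≫ widePullbackBase f = _ ≫ widePullbackBase f
      rw [Category.assoc, widePullbackCons_base, pullback.lift_fst_assoc, Category.id_comp,
        widePullbackTail_base]
  inv_hom_id := by
    refine pullback.hom_ext (WidePullback.hom_ext _ _ _ (fun j => ?_) ?_) ?_
    · rw [Category.assoc, Category.assoc, pullback.lift_fst_assoc, widePullbackTail_π,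
        widePullbackCons_π_succ, Category.id_comp]
    · change ((_ ≫ _) ≫ _) ≫ widePullbackBase _ = (_ ≫ _) ≫ widePullbackBase _
      rw [Category.assoc, Category.assoc, pullback.lift_fst_assoc, widePullbackTail_base,
        widePullbackCons_base, Category.id_comp]
    · rw [Category.assoc, pullback.lift_snd, widePullbackCons_π_zero, Category.id_comp]

theorem widePullbackSuccIso_hom_fst :
    (widePullbackSuccIso f).hom ≫ pullback.fst _ _ ≫ widePullbackBase _ = widePullbackBase f := by
  rw [widePullbackSuccIso, pullback.lift_fst_assoc, widePullbackTail_base]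

end WidePullback

theorem locallyOfFiniteType_base {X S : Scheme.{u}} (f : X ⟶ S) [LocallyOfFiniteType f] (h : ℕ) :
    LocallyOfFiniteType (widePullbackBase (fun _ : Fin h => f)) := by
  induction h with
  | zero =>
    have : IsIso (widePullbackBase (fun _ : Fin 0 => f)) :=
      ⟨WidePullback.lift (𝟙 S) (fun j => j.elim0) (fun j => j.elim0),
        WidePullback.hom_ext _ _ _ (fun j => j.elim0)
          ((Category.assoc _ _ _).trans
            ((congrArg _ (WidePullback.lift_base _ _ _ _)).trans
              ((Category.comp_id _).trans (Category.id_comp _).symm))),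
        WidePullback.lift_base _ _ _ _⟩
    infer_instance
  | succ h ih =>
    rw [← widePullbackSuccIso_hom_fst (fun _ : Fin (h + 1) => f)]
    infer_instance

/-- A closed point of `X^h` comes from a section of the structure morphism; its projection is then a
`k`-point of `X`, which is closed. -/
theorem isClosed_powerProj {X : Scheme.{u}} [X.Over (Spec (CommRingCat.of k))]
    [LocallyOfFiniteType (X ↘ Spec (CommRingCat.of k))] {h : ℕ} {z : power k X h}
    (hz : IsClosed {z}) (j : Fin h) : IsClosed {powerProj k X h j z} := by
  have := locallyOfFiniteType_base (X ↘ Spec (CommRingCat.of k)) h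
  let p := pointOfClosedPoint (widePullbackBase (fun _ : Fin h => X ↘ Spec (CommRingCat.of k))) z hz
  have hp : (p ≫ powerProj k X h j) ≫ (X ↘ Spec (CommRingCat.of k)) = 𝟙 _ :=
    (Category.assoc _ _ _).trans ((congrArg _ (WidePullback.π_arrow _ j)).trans
      (pointOfClosedPoint_comp _ z hz))
  have h1 := (pointEquivClosedPoint (X ↘ Spec (CommRingCat.of k)) ⟨_, hp⟩).2
  have h2 : (pointEquivClosedPoint (X ↘ Spec (CommRingCat.of k)) ⟨_, hp⟩).1 =
      powerProj k X h j z := by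
    exact congrArg (powerProj k X h j) (pointOfClosedPoint_apply _ z hz _)
  rw [← h2]
  exact h1

end ClosedPoints

/-! ### Evaluation in the dual numbers. -/

section DualNumbers

variable {k : Type*} [Field k]

theorem isUnit_iff_evaluation_ne_zero {R : Type*} [CommRing R] [IsLocalRing R] [Algebra k R]
    (ev : R →ₐ[k] k) (a : R) : IsUnit a ↔ ev a ≠ 0 := by
  refine ⟨fun h => (h.map ev).ne_zero, fun h => ?_⟩
  by_contra ha
  have h1 : algebraMap k R (ev a) - a ∈ nonunits R := fun hu => by
    simpa using (hu.map ev).ne_zero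
  have h2 := IsLocalRing.nonunits_add h1 ha
  rw [sub_add_cancel] at h2
  exact h2 ((IsUnit.mk0 _ h).map _)

theorem fst_aeval_dualNumber {ι : Type*} (w : ι → DualNumber k) (F : MvPolynomial ι k) :
    (aeval w F).fst = eval (fun l => (w l).fst) F := by
  have h : (aeval fun l => (w l).fst : MvPolynomial ι k →ₐ[k] k) =
      (TrivSqZeroExt.fstHom k k k).comp (aeval w) := by
    ext l
    simp
  rw [← aeval_eq_eval]
  exact (congrArg (fun g => g F) h).symm

/-- First-order Taylor expansion, `F(p + εv) = F(p) + ε dF_p(v)`. -/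
theorem snd_aeval_dualNumber {ι : Type*} [Fintype ι] (w : ι → DualNumber k)
    (F : MvPolynomial ι k) :
    (aeval w F).snd = ∑ l, eval (fun l => (w l).fst) (pderiv l F) * (w l).snd := by
  classical
  induction F using MvPolynomial.induction_on with
  | C a => simp [TrivSqZeroExt.algebraMap_eq_inl]
  | add p q hp hq => simp [hp, hq, add_mul, Finset.sum_add_distrib]
  | mul_X p m hp =>
    simp only [map_mul, aeval_X, TrivSqZeroExt.snd_mul, hp, fst_aeval_dualNumber, Derivation.leibniz,
      pderiv_X, smul_eq_mul, map_add, eval_X, add_mul, Finset.sum_add_distrib,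
      MulOpposite.smul_eq_mul_unop, MulOpposite.unop_op]
    congr 1
    · simp [Pi.single_apply, apply_ite, ite_mul]
    · rw [Finset.sum_mul]
      exact Finset.sum_congr rfl fun _ _ => by ring

/-- A homogeneous polynomial which takes the same values as `f` where the variable `j` is `1`. -/
theorem exists_homogenization {ι : Type*} (j : ι) (f : MvPolynomial ι k) :
    ∃ (d : ℕ) (F : MvPolynomial ι k), F.IsHomogeneous d ∧
      ∀ {B : Type u} [CommRing B] [Algebra k B] (b : ι → B), b j = 1 → aeval b F = aeval b f := by
  refine ⟨f.totalDegree, ∑ d ∈ Finset.range (f.totalDegree + 1),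
    X j ^ (f.totalDegree - d) * homogeneousComponent d f, ?_, fun b hb => ?_⟩
  · refine IsHomogeneous.sum _ _ _ fun d hd => ?_
    have h := ((isHomogeneous_X k j).pow (f.totalDegree - d)).mul
      (homogeneousComponent_isHomogeneous d f)
    have h2 : 1 * (f.totalDegree - d) + d = f.totalDegree := by
      have := Finset.mem_range.mp hd
      omega
    rwa [h2] at h
  · conv_rhs => rw [← sum_homogeneousComponent f]
    simp [hb]

theorem aeval_mul_of_isHomogeneous {ι A B : Type*} [CommSemiring A] [CommSemiring B] [Algebra A B]
    {F : MvPolynomial ι A} {d : ℕ} (hF : F.IsHomogeneous d) (c : B) (g : ι → B) :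
    aeval (fun l => c * g l) F = c ^ d * aeval g F :=
  eval₂_mul_of_isHomogeneous _ hF c g

variable {R : Type u} [CommRing R] [Algebra k R] {ι : Type*} {r : ι → R}

/-- Here `q = w / w_j`. Homogenizing `f` with respect to the variable `j` and scaling by `w_j`
reduces an arbitrary relation to a homogeneous one. -/
theorem aeval_eq_zero_of_homogeneous {B : Type u} [CommRing B] [Algebra k B] {j : ι} (hr : r j = 1)
    {w q : ι → B} (hq : ∀ l, w j * q l = w l) (hqj : q j = 1) (hw : IsUnit (w j))
    (h : ∀ (d : ℕ) (F : MvPolynomial ι k), F.IsHomogeneous d → aeval r F = 0 → aeval w F = 0)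
    (f : MvPolynomial ι k) (hf : aeval r f = 0) : aeval q f = 0 := by
  obtain ⟨d, F, hF, hFf⟩ := exists_homogenization.{u} j f
  have h1 := h d F hF (by rw [hFf r hr, hf])
  rw [← funext hq, aeval_mul_of_isHomogeneous hF, hFf q hqj] at h1
  exact ((hw.pow d).mul_right_eq_zero).mp h1

/-- `R` is a quotient of the polynomial ring localized at the polynomials that are units at `r`.
These are also units at `q`, since a dual number is a unit as soon as its first component is; so
evaluation at `q` descends to `R`. -/
theorem exists_lift_dualNumber (hr : GeneratesFractions k r) (ev : R →ₐ[k] k)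
    (q : ι → DualNumber k) (hq : ∀ l, (q l).fst = ev (r l))
    (h : ∀ f : MvPolynomial ι k, aeval r f = 0 → aeval q f = 0) :
    ∃ φ : R →ₐ[k] DualNumber k, (∀ l, φ (r l) = q l) ∧ ∀ a, (φ a).fst = ev a := by
  let M : Submonoid (MvPolynomial ι k) := (IsUnit.submonoid R).comap (aeval r)
  have hfst : ∀ f : MvPolynomial ι k, (aeval q f).fst = ev (aeval r f) := fun f => by
    rw [fst_aeval_dualNumber, funext hq, ← aeval_eq_eval]
    exact (comp_aeval_apply _ ev f).symm
  let ρ : Localization M →+* R := IsLocalization.lift (M := M) (g := (aeval r).toRingHom)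
    fun g => g.2
  have hσu : ∀ g : M, IsUnit ((aeval q).toRingHom (g : MvPolynomial ι k)) := fun g => by
    refine TrivSqZeroExt.isUnit_iff_isUnit_fst.mpr ?_
    change IsUnit (aeval q (g : MvPolynomial ι k)).fst
    rw [hfst]
    exact g.2.map ev
  let σ : Localization M →+* DualNumber k := IsLocalization.lift (M := M) hσu
  have hρ : Function.Surjective ρ := fun a => by
    obtain ⟨F, G, hG, hFG⟩ := hr a
    refine ⟨IsLocalization.mk' _ F (⟨G, hG⟩ : M), ?_⟩
    refine (IsLocalization.lift_mk'_spec _ _ _ _).mpr ?_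
    rw [mul_comm]
    exact hFG.symm
  have hker : RingHom.ker ρ ≤ RingHom.ker σ := fun a ha => by
    obtain ⟨f, g, rfl⟩ := IsLocalization.exists_mk'_eq M a
    rw [RingHom.mem_ker] at ha ⊢
    have h1 := (IsLocalization.lift_mk'_spec _ _ _ _).mp ha
    rw [mul_zero] at h1
    refine (IsLocalization.lift_mk'_spec _ _ _ _).mpr ?_
    rw [mul_zero]
    exact h f h1
  let φ : R →+* DualNumber k := RingHom.liftOfSurjective ρ hρ ⟨σ, hker⟩
  have hφ : ∀ f, φ (aeval r f) = aeval q f := fun f => by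
    have h1 : ρ (algebraMap _ _ f) = aeval r f := IsLocalization.lift_eq _ _
    have h2 : σ (algebraMap _ _ f) = aeval q f := IsLocalization.lift_eq _ _
    rw [← h1, ← h2]
    exact RingHom.liftOfRightInverse_comp_apply _ _ _ _ _
  refine ⟨⟨φ, fun c => ?_⟩, fun l => ?_, fun a => ?_⟩
  · have := hφ (C c)
    rwa [aeval_C, aeval_C] at this
  · have := hφ (X l)
    rwa [aeval_X, aeval_X] at this
  · obtain ⟨F, G, hG, hFG⟩ := hr a
    have h1 := congrArg (fun b => (φ b).fst) hFG
    simp only [map_mul, hφ, TrivSqZeroExt.fst_mul, hfst] at h1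
    have h2 := congrArg ev hFG
    rw [map_mul, ← h1] at h2
    exact (mul_right_cancel₀ (hG.map ev).ne_zero h2).symm

end DualNumbers

/-! ### Products of sections. -/

section LocalEquations

variable {X : Scheme.{u}} [AlgebraicGeometry.IsIntegral X]

theorem exists_isLocalEquation (D : CartierDivisor X) (x : X) : ∃ f, IsLocalEquation D x f := by
  obtain ⟨f, hf⟩ := QuotientGroup.mk_surjective
    ((D.toMul : ∀ x : X, X.functionFieldˣ ⧸ localUnits X x) x)
  exact ⟨f, hf.symm⟩

theorem IsLocalEquation.sum {ι : Type*} (t : Finset ι) {D : ι → CartierDivisor X} {x : X}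
    {f : ι → X.functionFieldˣ} (hf : ∀ o, IsLocalEquation (D o) x (f o)) :
    IsLocalEquation (∑ o ∈ t, D o) x (∏ o ∈ t, f o) := by
  classical
  induction t using Finset.induction_on with
  | empty => simp only [Finset.sum_empty, Finset.prod_empty]; rfl
  | insert a t ha ih =>
    rw [Finset.sum_insert ha, Finset.prod_insert ha, IsLocalEquation, QuotientGroup.mk_mul, ← ih,
      ← hf a]
    rfl

variable {k : Type u} [Field k] [X.Over (Spec (CommRingCat.of k))]

/-- Local equations multiply when divisors are added, and any other local equation of the sum
differs by a unit of the local ring. -/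
theorem prod_mem_globalSections {ι : Type*} (t : Finset ι) {D : ι → CartierDivisor X}
    {φ : ι → X.functionField} (hφ : ∀ o, φ o ∈ globalSections k (D o)) :
    ∏ o ∈ t, φ o ∈ globalSections k (∑ o ∈ t, D o) := by
  intro x f hf
  choose g hg using fun o => exists_isLocalEquation (D o) x
  have h1 := IsLocalEquation.sum t hg
  have h2 : ((∏ o ∈ t, g o : X.functionFieldˣ) : X.functionFieldˣ ⧸ localUnits X x) = f := by
    rw [← h1, hf]
  obtain ⟨u, hu⟩ := QuotientGroup.eq.mp h2
  have h3 : f = (∏ o ∈ t, g o) * Units.map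
      (algebraMap (X.presheaf.stalk x) X.functionField).toMonoidHom u := by
    rw [hu, mul_inv_cancel_left]
  rw [h3, Units.val_mul, Units.coe_prod, ← mul_assoc, ← Finset.prod_mul_distrib]
  exact mul_mem (prod_mem fun o _ => hφ o x (g o) (hg o)) ⟨_, rfl⟩

end LocalEquations

/-! ### Coordinates at a point, tangent vectors, separation of points. -/

section Sections

variable {k : Type u} [Field k]

theorem exists_X_notMem_pointIdeal {N : ℕ} (y : ProjectiveSpace k N) :
    ∃ j, MvPolynomial.X j ∉ pointIdeal y := by
  have h := Proj.iSup_basicOpen_eq_top' (homogeneousSubmodule (Fin (N + 1)) k)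
    (fun j : Fin (N + 1) => MvPolynomial.X j) (fun j => ⟨1, isHomogeneous_X k j⟩) (by
      refine top_le_iff.mp fun F _ => ?_
      induction F using MvPolynomial.induction_on with
      | C a =>
        exact Subalgebra.algebraMap_mem _
          (⟨C a, isHomogeneous_C _ a⟩ : homogeneousSubmodule (Fin (N + 1)) k 0)
      | add p q hp hq => exact add_mem (hp trivial) (hq trivial)
      | mul_X p j hp => exact mul_mem (hp trivial) (Algebra.subset_adjoin ⟨j, rfl⟩))
  obtain ⟨j, hj⟩ := TopologicalSpace.Opens.mem_iSup.mp (h.ge (TopologicalSpace.Opens.mem_top y))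
  exact ⟨j, hj⟩

theorem eq_of_homogeneous_mem_iff {N : ℕ} {y z : ProjectiveSpace k N}
    (h : ∀ (d : ℕ) (F : MvPolynomial (Fin (N + 1)) k), F.IsHomogeneous d →
      (F ∈ pointIdeal y ↔ F ∈ pointIdeal z)) : y = z :=
  ProjectiveSpectrum.ext (HomogeneousIdeal.ext' fun d F hF => h d F hF)

variable {X : Scheme.{u}} [AlgebraicGeometry.IsIntegral X] [X.Over (Spec (CommRingCat.of k))]
  {N : ℕ} {i : X ⟶ ProjectiveSpace k N} {D : CartierDivisor X} {s : Fin (N + 1) → X.functionField}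

theorem IsDefinedBySections.exists_unit (h : IsDefinedBySections i D s) {x : X} {j : Fin (N + 1)}
    (hj : MvPolynomial.X j ∉ pointIdeal (i x)) {f : X.functionFieldˣ} (hf : IsLocalEquation D x f) :
    ∃ u : (X.presheaf.stalk x)ˣ, algebraMap (X.presheaf.stalk x) X.functionField u = s j * f :=
  (h.generatesAt_iff x j).mpr hj f hf

theorem IsDefinedBySections.ne_zero (h : IsDefinedBySections i D s) {x : X} {j : Fin (N + 1)}
    (hj : MvPolynomial.X j ∉ pointIdeal (i x)) : s j ≠ 0 := by
  obtain ⟨f, hf⟩ := exists_isLocalEquation D x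
  obtain ⟨u, hu⟩ := h.exists_unit hj hf
  intro h0
  rw [h0, zero_mul] at hu
  exact (u.isUnit.map (algebraMap (X.presheaf.stalk x) X.functionField)).ne_zero hu

/-- Normalized homogeneous coordinates of the image of a closed point, and the corresponding
elements of its local ring. -/
structure IsCoordinateSystem (i : X ⟶ ProjectiveSpace k N) (s : Fin (N + 1) → X.functionField)
    (x : X) (j : Fin (N + 1)) (r : Fin (N + 1) → X.presheaf.stalk x) : Prop where
  notMem : MvPolynomial.X j ∉ pointIdeal (i x)
  ne_zero : s j ≠ 0
  algebraMap_ratio : ∀ l, algebraMap (X.presheaf.stalk x) X.functionField (r l) = s l / s j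
  isUnit_iff : ∀ (d : ℕ) (F : MvPolynomial (Fin (N + 1)) k), F.IsHomogeneous d →
        (IsUnit (aeval r F) ↔ F ∉ pointIdeal (i x))
  generates : IsClosedImmersion i → GeneratesFractions k r

theorem IsDefinedBySections.exists_isCoordinateSystem (h : IsDefinedBySections i D s) (x : X) :
    ∃ j r, IsCoordinateSystem i s x j r := by
  obtain ⟨j, hj⟩ := exists_X_notMem_pointIdeal (i x)
  obtain ⟨r, h1, h2, h3⟩ := h.exists_ratios x hj
  exact ⟨j, r, hj, h.ne_zero hj, h1, h2, h3⟩

namespace IsCoordinateSystem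

variable {x : X} {j : Fin (N + 1)} {r : Fin (N + 1) → X.presheaf.stalk x}

theorem ratio_self (H : IsCoordinateSystem i s x j r) : r j = 1 := by
  apply algebraMap_stalk_injective x
  rw [H.algebraMap_ratio, map_one, div_self H.ne_zero]

theorem algebraMap_sum (H : IsCoordinateSystem i s x j r) (c : Fin (N + 1) → k) :
    algebraMap (X.presheaf.stalk x) X.functionField (∑ l, c l • r l) = (∑ l, c l • s l) / s j := by
  rw [map_sum, Finset.sum_div]
  refine Finset.sum_congr rfl fun l _ => ?_
  rw [Algebra.smul_def, Algebra.smul_def, map_mul, H.algebraMap_ratio, mul_div_assoc,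
    ← IsScalarTower.algebraMap_apply]

theorem mem_pointIdeal_iff (H : IsCoordinateSystem i s x j r) (ev : X.presheaf.stalk x →ₐ[k] k)
    {d : ℕ} {F : MvPolynomial (Fin (N + 1)) k} (hF : F.IsHomogeneous d) :
    F ∈ pointIdeal (i x) ↔ eval (fun l => ev (r l)) F = 0 := by
  have h1 := H.isUnit_iff d F hF
  have h2 : ev (aeval r F) = eval (fun l => ev (r l)) F := by
    rw [← aeval_eq_eval]
    exact comp_aeval_apply _ ev F
  rw [isUnit_iff_evaluation_ne_zero ev, h2] at h1
  exact (not_iff_not.mp h1).symm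

theorem isHomogeneousCoordinates (H : IsCoordinateSystem i s x j r)
    (ev : X.presheaf.stalk x →ₐ[k] k) : IsHomogeneousCoordinates (i x) fun l => ev (r l) := by
  refine ⟨fun h0 => ?_, fun d F hF => H.mem_pointIdeal_iff ev hF⟩
  have := congrFun h0 j
  simp [H.ratio_self] at this

/-- Since `s = s_j r`, a homogeneous relation among the ratios at one point is a relation among
rational functions, which no longer depends on the point. -/
theorem aeval_ratio_eq_zero_iff (H : IsCoordinateSystem i s x j r) {d : ℕ}
    {F : MvPolynomial (Fin (N + 1)) k} (hF : F.IsHomogeneous d) :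
    aeval r F = 0 ↔ aeval s F = 0 := by
  have h1 : aeval s F = s j ^ d * algebraMap (X.presheaf.stalk x) X.functionField (aeval r F) := by
    have h2 : algebraMap (X.presheaf.stalk x) X.functionField (aeval r F) =
        aeval (fun l => algebraMap (X.presheaf.stalk x) X.functionField (r l)) F :=
      comp_aeval_apply r (IsScalarTower.toAlgHom k (X.presheaf.stalk x) X.functionField) F
    rw [h2, ← aeval_mul_of_isHomogeneous hF]
    congr 2
    funext l
    rw [H.algebraMap_ratio, mul_div_cancel₀ _ H.ne_zero]
  rw [h1, mul_eq_zero, or_iff_right (pow_ne_zero _ H.ne_zero),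
    map_eq_zero_iff _ (algebraMap_stalk_injective x)]

theorem mem_pointIdeal_of_aeval_eq_zero (H : IsCoordinateSystem i s x j r) {d : ℕ}
    {F : MvPolynomial (Fin (N + 1)) k} (hF : F.IsHomogeneous d) (h : aeval s F = 0) :
    F ∈ pointIdeal (i x) := by
  by_contra hx
  have := (H.isUnit_iff d F hF).mpr hx
  rw [(H.aeval_ratio_eq_zero_iff hF).mpr h] at this
  exact not_isUnit_zero this

/-- A tangent vector of the cone over `X` at a point over `x` extends the evaluation at `x` to an
algebra map to the dual numbers. -/
theorem exists_tangentLift [IsClosedImmersion i] (hs : IsDefinedBySections i D s)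
    (H : IsCoordinateSystem i s x j r) (ev : X.presheaf.stalk x →ₐ[k] k) {v : Fin (N + 1) → k}
    (hv : v ∈ tangentSpace i x) :
    ∃ φ : X.presheaf.stalk x →ₐ[k] DualNumber k, (∀ a, (φ a).fst = ev a) ∧
      ∀ l, (TrivSqZeroExt.inl 1 + TrivSqZeroExt.inr (v j)) * φ (r l) =
        (TrivSqZeroExt.inl (ev (r l)) + TrivSqZeroExt.inr (v l)) := by
  -- The point `p + εv`, where `p = ev ∘ r` are homogeneous coordinates of `x`.
  let w : Fin (N + 1) → DualNumber k := fun l =>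
    TrivSqZeroExt.inl (ev (r l)) + TrivSqZeroExt.inr (v l)
  have hwj : w j = TrivSqZeroExt.inl 1 + TrivSqZeroExt.inr (v j) := by
    simp only [w, H.ratio_self, map_one]
  have hwfst : ∀ l, (w l).fst = ev (r l) := fun l => by simp [w]
  have hwsnd : ∀ l, (w l).snd = v l := fun l => by simp [w]
  have hunit : IsUnit (w j) := by
    rw [TrivSqZeroExt.isUnit_iff_isUnit_fst, hwfst, H.ratio_self, map_one]
    exact isUnit_one
  obtain ⟨W, hW⟩ := hunit
  have hWinv : (↑W⁻¹ : DualNumber k).fst = 1 := by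
    have h1 := congrArg TrivSqZeroExt.fst W.mul_inv
    rwa [TrivSqZeroExt.fst_mul, hW, hwfst, H.ratio_self, map_one, one_mul,
      TrivSqZeroExt.fst_one] at h1
  let q : Fin (N + 1) → DualNumber k := fun l => ↑W⁻¹ * w l
  have hq : ∀ l, w j * q l = w l := fun l => by
    rw [← hW]
    exact W.mul_inv_cancel_left _
  have hhom : ∀ (d : ℕ) (F : MvPolynomial (Fin (N + 1)) k), F.IsHomogeneous d → aeval r F = 0 →
      aeval w F = 0 := by
    intro d F hF h0
    -- A relation in the local ring at `x` holds on all of `X`, so the equations defining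
    -- `tangentSpace` apply to it.
    have hX : ∀ z : X, F ∈ pointIdeal (i z) := fun z => by
      obtain ⟨j', r', H'⟩ := hs.exists_isCoordinateSystem z
      exact H'.mem_pointIdeal_of_aeval_eq_zero hF ((H.aeval_ratio_eq_zero_iff hF).mp h0)
    refine TrivSqZeroExt.ext ?_ ?_
    · rw [fst_aeval_dualNumber, funext hwfst]
      exact (H.mem_pointIdeal_iff ev hF).mp (hX x)
    · rw [snd_aeval_dualNumber, funext hwfst]
      simp only [hwsnd]
      exact hv d F hF hX _ (H.isHomogeneousCoordinates ev)
  obtain ⟨φ, hφ, hfst⟩ := exists_lift_dualNumber (H.generates ‹_›) ev q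
    (fun l => by rw [TrivSqZeroExt.fst_mul, hWinv, one_mul, hwfst])
    (aeval_eq_zero_of_homogeneous H.ratio_self hq
      (by
        change (↑W⁻¹ : DualNumber k) * w j = 1
        rw [← hW, W.inv_mul]) (hW ▸ W.isUnit) hhom)
  refine ⟨φ, hfst, fun l => ?_⟩
  rw [hφ, ← hwj, hq]

theorem exists_sum_mul (H : IsCoordinateSystem i s x j r) (hs : IsDefinedBySections i D s)
    (ev : X.presheaf.stalk x →ₐ[k] k) (c : Fin (N + 1) → k) {f : X.functionFieldˣ}
    (hf : IsLocalEquation D x f) :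
    ∃ a, (ev a = 0 ↔ ∑ l, c l * ev (r l) = 0) ∧
      algebraMap (X.presheaf.stalk x) X.functionField a = (∑ l, c l • s l) * f := by
  obtain ⟨u, hu⟩ := hs.exists_unit H.notMem hf
  refine ⟨(∑ l, c l • r l) * u, ?_, ?_⟩
  · rw [map_mul, mul_eq_zero, or_iff_left (u.isUnit.map ev).ne_zero]
    simp only [map_sum, map_smul, smul_eq_mul]
  · rw [map_mul, H.algebraMap_sum, hu, ← mul_assoc, div_mul_cancel₀ _ H.ne_zero]

end IsCoordinateSystem

/-- A very ample divisor separates closed points. -/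
theorem IsVeryAmple.exists_separating {D : CartierDivisor X} (hD : IsVeryAmple k D) {x y : X}
    (hxy : x ≠ y) (evx : X.presheaf.stalk x →ₐ[k] k) (evy : X.presheaf.stalk y →ₐ[k] k) :
    ∃ τ ∈ globalSections k D,
      (∀ f, IsLocalEquation D x f → ∃ a, evx a ≠ 0 ∧
        algebraMap (X.presheaf.stalk x) X.functionField a = τ * f) ∧
      ∀ f, IsLocalEquation D y f → ∃ a, evy a = 0 ∧
        algebraMap (X.presheaf.stalk y) X.functionField a = τ * f := by
  obtain ⟨M, i, s, hi, hs⟩ := hD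
  obtain ⟨jx, r, Hx⟩ := hs.exists_isCoordinateSystem x
  obtain ⟨jy, r', Hy⟩ := hs.exists_isCoordinateSystem y
  -- If all 2 × 2 minors vanished, the coordinate vectors of `x` and `y` would be proportional,
  -- against injectivity of `i`.
  obtain ⟨a, b, hab⟩ : ∃ a b, evx (r a) * evy (r' b) - evx (r b) * evy (r' a) ≠ 0 := by
    by_contra! h
    refine hxy (i.isClosedEmbedding.injective ?_)
    have h1 : ∀ b, evy (r' b) = evy (r' jx) * evx (r b) := fun b => by
      have := h jx b
      rw [Hx.ratio_self, map_one, one_mul, sub_eq_zero] at this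
      rw [this, mul_comm]
    have h2 : evy (r' jx) ≠ 0 := fun h0 => by
      have := h1 jy
      rw [h0, zero_mul, Hy.ratio_self, map_one] at this
      exact one_ne_zero this
    refine eq_of_homogeneous_mem_iff (k := k) fun d F hF => ?_
    have h3 := aeval_mul_of_isHomogeneous hF (evy (r' jx)) fun l => evx (r l)
    rw [Hx.mem_pointIdeal_iff evx hF, Hy.mem_pointIdeal_iff evy hF, funext h1, ← aeval_eq_eval,
      ← aeval_eq_eval]
    change aeval (fun l => evx (r l)) F = 0 ↔ aeval (fun l => evy (r' jx) * evx (r l)) F = 0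
    rw [h3, mul_eq_zero, or_iff_right (pow_ne_zero _ h2)]
  -- The linear form given by the `(a, b)` minor with the coordinates of `y`: it vanishes at `y`
  -- and, by `hab`, not at `x`.
  let c : Fin (M + 1) → k := Pi.single a (evy (r' b)) - Pi.single b (evy (r' a))
  have hc : ∀ p : Fin (M + 1) → k, ∑ l, c l * p l = p a * evy (r' b) - p b * evy (r' a) := by
    intro p
    simp only [c, Pi.sub_apply, sub_mul, Finset.sum_sub_distrib, Pi.single_apply, ite_mul,
      zero_mul, Finset.sum_ite_eq', Finset.mem_univ, if_true]
    ring
  refine ⟨∑ l, c l • s l, sum_mem fun l _ => Submodule.smul_mem _ _ (hs.mem_globalSections l),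
    fun f hf => ?_, fun f hf => ?_⟩
  · obtain ⟨g, hg, hgf⟩ := Hx.exists_sum_mul hs evx c hf
    refine ⟨g, fun h0 => hab ?_, hgf⟩
    rw [← hc fun l => evx (r l)]
    exact hg.mp h0
  · obtain ⟨g, hg, hgf⟩ := Hy.exists_sum_mul hs evy c hf
    refine ⟨g, hg.mpr ?_, hgf⟩
    rw [hc fun l => evy (r' l)]
    ring

end Sections

/-! ### Independence of subspaces tested by linear forms. -/

section LinearAlgebra

variable {k V ι : Type*} [Field k] [AddCommGroup V] [Module k V]

theorem finrank_iSup_of_iSupIndep [Fintype ι] [FiniteDimensional k V] {W : ι → Submodule k V}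
    (hW : iSupIndep W) : Module.finrank k ↥(⨆ j, W j) = ∑ j, Module.finrank k (W j) := by
  classical
  rw [Submodule.iSup_eq_range_dfinsupp_lsum,
    LinearMap.finrank_range_of_inj hW.dfinsupp_lsum_injective]
  exact Module.finrank_directSum k fun j => W j

theorem iSupIndep_of_forall_dual {W : ι → Submodule k V}
    (h : ∀ j, ∀ v ∈ W j, (∀ ℓ : V →ₗ[k] k, (∀ j' ≠ j, ∀ v' ∈ W j', ℓ v' = 0) → ℓ v = 0) → v = 0) :
    iSupIndep W := by
  intro j
  rw [Submodule.disjoint_def]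
  refine fun v hv hv' => h j v hv fun ℓ hℓ => ?_
  have h1 : ⨆ j', ⨆ (_ : j' ≠ j), W j' ≤ LinearMap.ker ℓ :=
    iSup₂_le fun j' hj' v' hv' => hℓ j' hj' v' hv'
  exact h1 hv'

end LinearAlgebra

/-! ### Detecting tangent vectors in other coordinates. -/

section Tangent

variable {k : Type*} [Field k] {R : Type*} [CommRing R] [Algebra k R] {ι ι' : Type*}

/-- The factor `1 + ε v_j` records the radial direction of the cone, invisible to `φ`. The index
`m`, where `r' m = 1`, isolates the contribution of `u` and `v_j`; subtracting it shows that `φ` has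
no `ε`-part on the `r' l`, hence none on `R`, and then `v_j = 0` as well. -/
theorem eq_zero_of_snd_eq_zero [Fintype ι'] {r : ι → R} {j : ι} {r' : ι' → R} {m : ι'}
    (hr' : GeneratesFractions k r') (hm : r' m = 1) (ev : R →ₐ[k] k) (φ : R →ₐ[k] DualNumber k)
    (hφ : ∀ a, (φ a).fst = ev a) {v : ι → k}
    (hv : ∀ l, (TrivSqZeroExt.inl 1 + TrivSqZeroExt.inr (v j)) * φ (r l) =
        (TrivSqZeroExt.inl (ev (r l)) + TrivSqZeroExt.inr (v l)))
    (u : R) (hu : ev u ≠ 0)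
    (h : ∀ l, ((TrivSqZeroExt.inl 1 + TrivSqZeroExt.inr (v j)) * φ (r' l * u)).snd = 0) :
    v = 0 := by
  have h1 : (φ u).snd + ev u * v j = 0 := by
    have := h m
    simpa [hm, hφ, mul_comm] using this
  have h2 : ∀ l, (φ (r' l)).snd = 0 := fun l => by
    have h3 := h l
    simp only [map_mul, TrivSqZeroExt.snd_mul, TrivSqZeroExt.fst_mul, TrivSqZeroExt.fst_add,
      TrivSqZeroExt.snd_add, TrivSqZeroExt.fst_inl, TrivSqZeroExt.snd_inl, TrivSqZeroExt.fst_inr,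
      TrivSqZeroExt.snd_inr, hφ, smul_eq_mul, MulOpposite.smul_eq_mul_unop,
      MulOpposite.unop_op] at h3
    have h4 : (φ (r' l)).snd * ev u = 0 := by linear_combination h3 - ev (r' l) * h1
    exact (mul_eq_zero.mp h4).resolve_right hu
  have h5 : ∀ F : MvPolynomial ι' k, (φ (aeval r' F)).snd = 0 := fun F => by
    have h6 := comp_aeval_apply r' φ F
    rw [h6, snd_aeval_dualNumber]
    simp [h2]
  have h7 : ∀ a, (φ a).snd = 0 := fun a => by
    obtain ⟨F, G, hG, hFG⟩ := hr' a
    have h8 := congrArg (fun b => (φ b).snd) hFG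
    simp only [map_mul, TrivSqZeroExt.snd_mul, h5, hφ, smul_eq_mul, mul_zero, zero_add,
      MulOpposite.smul_eq_mul_unop, MulOpposite.unop_op] at h8
    exact (mul_eq_zero.mp h8).resolve_right (hG.map ev).ne_zero
  have h9 : v j = 0 := by
    rw [h7, zero_add] at h1
    exact (mul_eq_zero.mp h1).resolve_left hu
  funext l
  have h10 := congrArg TrivSqZeroExt.snd (hv l)
  simpa [h9, h7] using h10.symm

end Tangent

/-! ### Linear forms on tangent spaces as products of sections. -/

section Sections

variable {k : Type u} [Field k] {X : Scheme.{u}} [AlgebraicGeometry.IsIntegral X]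
  [X.Over (Spec (CommRingCat.of k))] {N : ℕ} {i : X ⟶ ProjectiveSpace k N} {L : CartierDivisor X}
  {s : Fin (N + 1) → X.functionField}

/-- The value of a linear form at a tangent vector, in terms of the corresponding section. -/
theorem IsCoordinateSystem.sum_mul_eq_snd {x : X} {j : Fin (N + 1)}
    {r : Fin (N + 1) → X.presheaf.stalk x} (H : IsCoordinateSystem i s x j r)
    {ev : X.presheaf.stalk x →ₐ[k] k} {φ : X.presheaf.stalk x →ₐ[k] DualNumber k}
    {v : Fin (N + 1) → k}
    (hv : ∀ l, (TrivSqZeroExt.inl 1 + TrivSqZeroExt.inr (v j)) * φ (r l) =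
        (TrivSqZeroExt.inl (ev (r l)) + TrivSqZeroExt.inr (v l))) {f : X.functionFieldˣ}
    (u : (X.presheaf.stalk x)ˣ)
    (hu : algebraMap (X.presheaf.stalk x) X.functionField u = s j * f) (c : Fin (N + 1) → k)
    (a : X.presheaf.stalk x)
    (ha : algebraMap (X.presheaf.stalk x) X.functionField a = (∑ l, c l • s l) * f) :
    ∑ l, c l * v l =
      ((TrivSqZeroExt.inl 1 + TrivSqZeroExt.inr (v j)) * φ (a * (u⁻¹ : (X.presheaf.stalk x)ˣ))).snd := by
  have h1 : ∑ l, c l • r l = a * (u⁻¹ : (X.presheaf.stalk x)ˣ) := by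
    rw [← Units.mul_inv_eq_iff_eq_mul, inv_inv]
    apply algebraMap_stalk_injective x
    rw [map_mul, H.algebraMap_sum, hu, ha, ← mul_assoc, div_mul_cancel₀ _ H.ne_zero]
  rw [← h1, map_sum, Finset.mul_sum]
  simp only [map_smul, mul_smul_comm, hv]
  simp [TrivSqZeroExt.snd_sum]

variable [IsClosedImmersion i]

/-- A product of sections two of which vanish at `x` vanishes on the tangent space at `x`. -/
theorem sum_mul_eq_zero_of_two_vanishing (hs : IsDefinedBySections i L s) {O : Type*} [Fintype O]
    {D : O → CartierDivisor X} (hL : L = ∑ o, D o) {φ : O → X.functionField}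
    (hφ : ∀ o, φ o ∈ globalSections k (D o)) {x : X} (ev : X.presheaf.stalk x →ₐ[k] k) {o₁ o₂ : O}
    (ho : o₁ ≠ o₂)
    (h₁ : ∀ f, IsLocalEquation (D o₁) x f → ∃ a, ev a = 0 ∧
      algebraMap (X.presheaf.stalk x) X.functionField a = φ o₁ * f)
    (h₂ : ∀ f, IsLocalEquation (D o₂) x f → ∃ a, ev a = 0 ∧
      algebraMap (X.presheaf.stalk x) X.functionField a = φ o₂ * f)
    (c : Fin (N + 1) → k) (hc : ∑ l, c l • s l = ∏ o, φ o) {v : Fin (N + 1) → k}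
    (hv : v ∈ tangentSpace i x) : ∑ l, c l * v l = 0 := by
  classical
  obtain ⟨j, r, H⟩ := hs.exists_isCoordinateSystem x
  obtain ⟨θ, hθ, hθv⟩ := H.exists_tangentLift hs ev hv
  choose f hf using fun o => exists_isLocalEquation (D o) x
  choose a ha using fun o => hφ o x (f o) (hf o)
  have hfL : IsLocalEquation L x (∏ o, f o) := hL ▸ IsLocalEquation.sum _ hf
  obtain ⟨u, hu⟩ := hs.exists_unit H.notMem hfL
  have hva : ∀ o, (∀ f, IsLocalEquation (D o) x f → ∃ a, ev a = 0 ∧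
      algebraMap (X.presheaf.stalk x) X.functionField a = φ o * f) → (θ (a o)).fst = 0 := by
    intro o h
    obtain ⟨b, hb, hbf⟩ := h (f o) (hf o)
    rw [hθ, ← hb]
    congr 1
    apply algebraMap_stalk_injective x
    rw [hbf]
    exact ha o
  rw [H.sum_mul_eq_snd hθv u hu c (∏ o, a o)]
  · have h3 : θ (∏ o, a o) = 0 := by
      rw [← Finset.mul_prod_erase _ _ (Finset.mem_univ o₁),
        ← Finset.mul_prod_erase _ _ (Finset.mem_erase.mpr ⟨ho.symm, Finset.mem_univ o₂⟩), ← mul_assoc,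
        map_mul, map_mul]
      have h4 : θ (a o₁) * θ (a o₂) = 0 := by
        refine TrivSqZeroExt.ext ?_ ?_ <;> simp [hva o₁ h₁, hva o₂ h₂]
      rw [h4, zero_mul]
    rw [map_mul, h3]
    simp
  · rw [map_prod, hc, Units.coe_prod, ← Finset.prod_mul_distrib]
    exact Finset.prod_congr rfl fun o _ => ha o

/-- The factor `∏ p, τ p` does not vanish at `x`, so the hypothesis `h0` bears on the `t m` alone;
these embed `X` and hence generate its local ring at `x`. -/
theorem eq_zero_of_sum_mul_eq_zero (hs : IsDefinedBySections i L s) {P : Type*} [Fintype P]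
    {D : Option P → CartierDivisor X} (hL : L = ∑ o, D o) {x : X}
    (ev : X.presheaf.stalk x →ₐ[k] k) {τ : P → X.functionField}
    (hτ : ∀ p f, IsLocalEquation (D (some p)) x f → ∃ a, ev a ≠ 0 ∧
      algebraMap (X.presheaf.stalk x) X.functionField a = τ p * f)
    {M : ℕ} {i' : X ⟶ ProjectiveSpace k M} [IsClosedImmersion i']
    {t : Fin (M + 1) → X.functionField}
    (ht : IsDefinedBySections i' (D none) t) {v : Fin (N + 1) → k} (hv : v ∈ tangentSpace i x)
    (c : Fin (M + 1) → Fin (N + 1) → k) (hc : ∀ m, ∑ l, c m l • s l = t m * ∏ p, τ p)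
    (h0 : ∀ m, ∑ l, c m l * v l = 0) : v = 0 := by
  obtain ⟨j, r, H⟩ := hs.exists_isCoordinateSystem x
  obtain ⟨m, r', H'⟩ := ht.exists_isCoordinateSystem x
  obtain ⟨θ, hθ, hθv⟩ := H.exists_tangentLift hs ev hv
  choose f hf using fun o => exists_isLocalEquation (D o) x
  choose a ha using fun p => hτ p (f (some p)) (hf (some p))
  have hfL : IsLocalEquation L x (∏ o, f o) := hL ▸ IsLocalEquation.sum _ hf
  obtain ⟨u, hu⟩ := hs.exists_unit H.notMem hfL
  obtain ⟨u', hu'⟩ := ht.exists_unit H'.notMem (hf none)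
  -- `u'` turns the ratios `r' l` back into the sections `t l`, and `u⁻¹` trivializes `L` as the
  -- coordinates `r` do.
  refine eq_zero_of_snd_eq_zero (H'.generates ‹_›) H'.ratio_self ev θ hθ hθv
    (u' * (∏ p, a p) * (u⁻¹ : (X.presheaf.stalk x)ˣ)) ?_ fun l => ?_
  · rw [map_mul, map_mul, map_prod]
    exact mul_ne_zero (mul_ne_zero (u'.isUnit.map ev).ne_zero
      (Finset.prod_ne_zero_iff.mpr fun p _ => (ha p).1)) ((u⁻¹).isUnit.map ev).ne_zero
  · rw [← mul_assoc, ← H.sum_mul_eq_snd hθv u hu (c l), h0]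
    rw [map_mul, map_mul, H'.algebraMap_ratio, hu', hc, map_prod, Units.coe_prod,
      Fintype.prod_option, Finset.prod_congr rfl fun p _ => (ha p).2, Finset.prod_mul_distrib]
    have := H'.ne_zero
    field_simp

end Sections

/-! ### Independence of tangent spaces and the conclusion. -/

section Main

variable {k : Type u} [Field k] {X : Scheme.{u}} [AlgebraicGeometry.IsIntegral X]
  [X.Over (Spec (CommRingCat.of k))] {N : ℕ} {i : X ⟶ ProjectiveSpace k N} {L : CartierDivisor X}

/-- If `L` is a sum of `2 h - 1` very ample divisors, then the tangent spaces of `X` at `h` distinct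
closed points are linearly independent. -/
theorem iSupIndep_tangentSpace (hi : IsEmbeddingByCompleteLinearSystem i L) {h : ℕ}
    {D : Fin (2 * h - 1) → CartierDivisor X} (hD : ∀ o, IsVeryAmple k (D o)) (hL : L = ∑ o, D o)
    {x : Fin h → X} (hx : Function.Injective x) (ev : ∀ j, X.presheaf.stalk (x j) →ₐ[k] k) :
    iSupIndep fun j => tangentSpace i (x j) := by
  obtain ⟨hci, s, hs, -, hspan⟩ := hi
  refine iSupIndep_of_forall_dual fun j v hv hℓ => ?_
  -- The count `2h - 1 = 1 + 2(h - 1)`: `none` labels the divisor reserved for `x j`, and each other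
  -- point gets two. The element `j` ensures `h ≥ 1`.
  have hcard : Fintype.card (Option ({j' // j' ≠ j} × Bool)) = Fintype.card (Fin (2 * h - 1)) := by
    have := j.2
    simp only [ne_eq, Fintype.card_option, Fintype.card_prod, Fintype.card_subtype_compl,
      Fintype.card_fin, Fintype.card_unique, Fintype.card_bool]
    omega
  let e := Fintype.equivOfCardEq hcard
  have hL' : L = ∑ o, D (e o) := by rw [hL, e.sum_comp]
  choose τ hτ hτx hτy using fun p : {j' // j' ≠ j} × Bool =>
    (hD (e (some p))).exists_separating (hx.ne p.1.2.symm) (ev j) (ev p.1.1)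
  obtain ⟨M, i', t, hi', ht⟩ := hD (e none)
  let φ : Fin (M + 1) → Option ({j' // j' ≠ j} × Bool) → X.functionField := fun m o =>
    o.elim (t m) τ
  have hφ : ∀ m o, φ m o ∈ globalSections k (D (e o)) := by
    rintro m (_ | p)
    · exact ht.mem_globalSections m
    · exact hτ p
  -- Completeness of the linear system makes the product a linear form on `ℙ^N`.
  have hmem : ∀ m, ∏ o, φ m o ∈ Submodule.span k (Set.range s) := fun m => by
    rw [hspan, hL']
    exact prod_mem_globalSections _ (hφ m)
  choose c hc using fun m => (Submodule.mem_span_range_iff_exists_fun k).mp (hmem m)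
  refine eq_zero_of_sum_mul_eq_zero hs hL' (ev j) hτx ht hv c (fun m => ?_) fun m => ?_
  · rw [hc, Fintype.prod_option]
    rfl
  · have h1 := hℓ (∑ l, c m l • LinearMap.proj l) fun j' hj' v' hv' => ?_
    · simpa using h1
    -- Both divisors assigned to `j'` contribute a zero at `x j'`.
    · have h2 := sum_mul_eq_zero_of_two_vanishing hs hL' (hφ m) (ev j')
        (o₁ := some (⟨j', hj'⟩, false)) (o₂ := some (⟨j', hj'⟩, true)) (by simp) (hτy _) (hτy _) _
        (hc m) hv'
      simpa using h2

/-- At smooth points the independent spaces have linear dimension `n + 1`, so their sum has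
projective dimension exactly `h(n + 1) - 1`, the first entry of the minimum. -/
theorem terraciniSet_eq_empty [IsAlgClosed k] (hi : IsEmbeddingByCompleteLinearSystem i L) {h : ℕ}
    {D : Fin (2 * h - 1) → CartierDivisor X} (hD : ∀ o, IsVeryAmple k (D o)) (hL : L = ∑ o, D o) :
    terraciniSet h i = ∅ := by
  refine Set.eq_empty_of_forall_notMem ?_
  rintro ξ ⟨z, hz, -, hinj, hsm, hlt⟩
  obtain ⟨hci, s, hs, -⟩ := id hi
  have hlft : LocallyOfFiniteType (X ↘ Spec (CommRingCat.of k)) := by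
    rw [← hs.isOver.1]
    infer_instance
  have ev : ∀ j, X.presheaf.stalk (powerProj k X h j z) →ₐ[k] k :=
    fun j => (exists_evaluation (isClosed_powerProj hz j)).some
  have hind := iSupIndep_tangentSpace hi hD hL hinj ev
  have hrank := finrank_iSup_of_iSupIndep hind
  have h1 : ∀ j, (Module.finrank k (tangentSpace i (powerProj k X h j z)) : ℤ) =
      dimension X + 1 := fun j => by
    have := hsm j
    rw [IsSmoothPoint, projDim] at this
    omega
  have h2 : projDim (⨆ j, tangentSpace i (powerProj k X h j z)) =
      (h : ℤ) * dimension X + h - 1 := by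
    rw [projDim, hrank]
    push_cast
    simp only [h1, Finset.sum_const, Finset.card_univ, Fintype.card_fin, nsmul_eq_mul]
    ring
  rw [h2] at hlt
  exact absurd (hlt.trans_le (min_le_left _ _)) (lt_irrefl _)

end Main

end Terracini
end

theorem proposition3p10 {k : Type u} [Field k] [IsAlgClosed k]
    (X : Scheme.{u}) [IsIntegral X] [X.Over (Spec (CommRingCat.of k))]
    (N : ℕ) (i : X ⟶ Terracini.ProjectiveSpace k N) (L : Terracini.CartierDivisor X)
    (hi : Terracini.IsEmbeddingByCompleteLinearSystem i L)
    (h : ℕ) (hh : 3 ≤ 2 * h - 1)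
    (D : Fin (2 * h - 1) → Terracini.CartierDivisor X)
    (hD : ∀ j, Terracini.IsVeryAmple k (D j))
    (hL : L = ∑ j, D j) :
    Terracini.terraciniLocus h i = ∅ := by
  rw [Terracini.terraciniLocus, Terracini.terraciniSet_eq_empty hi hD hL, closure_empty]
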